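/- Let $n\ge 0$ and let $\mathfrak g=Q(n)$ be the queer Lie superalgebra over $\mathbb C$, i.e. the Lie sub-superalgebra of $\mathfrak{gl}(n|n)$ of matrices $\begin{pmatrix}A&B\\B&A\end{pmatrix}$, with basis $e_{i,j}$ (even, $A=E_{ij}$, $B=0$) and $f_{i,j}$ (odd, $A=0$, $B=E_{ij}$). Let $\mathfrak h$, $\mathfrak n^{+}$, $\mathfrak n^{-}$ consist of the matrices with $A,B$ diagonal, strictly upper triangular, strictly lower triangular, respectively, and let $\mathfrak b=\mathfrak h\oplus\mathfrak n^+$. Let $\varphi$ be the linear functional with $\varphi(e_{i,j})=\delta_{i,j+1}$, $\varphi(f_{i,j})=0$, and let $I_\varphi$ be the left ideal of $U(\mathfrak g)$ generated by $x-\varphi(x)$, $x\in\mathfrak n^-$. The principal finite $W$-algebra is $$W=\{\,y+I_\varphi\in U(\mathfrak g)/I_\varphi \mid \operatorname{ad}(x)y\in I_\varphi\ \text{ for all } x\in\mathfrak n^-\,\},$$ regarded as a subalgebra of $U(\mathfrak b)$ through the identification $U(\mathfrak g)/I_\varphi\simeq U(\mathfrak b)$. It acts on $U(\mathfrak h)$-modules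 through the Harish-Chandra homomorphism $\vartheta:U(\mathfrak b)\to U(\mathfrak h)$, the projection with kernel $\mathfrak n^+U(\mathfrak b)$. Modules are $\mathbb Z/2$-graded, and a module is simple if it is non-zero and has no graded submodules other than $0$ and itself. Put $x_i=e_{i,i}\in U(\mathfrak h)$. For $\mathbf s=(s_1,\dots,s_n)\in\mathbb C^n$ let $V(\mathbf s)$ be the simple $U(\mathfrak h)$-module, unique up to isomorphism and change of parity, on which each $x_i$ acts as the scalar $s_i$. **Theorem.** If $\mathbf s$ is typical, that is, $s_i+s_j\neq 0$ for all $i\neq j$, then $V(\mathbf s)$ is a simple $W$-module. -/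

import Mathlib

noncomputable section

namespace QueerW

/-! ### Lie superalgebras inside `gl(n|n)` and their enveloping superalgebras -/

/-- The space of `(n|n) × (n|n)` complex matrices; `Sum.inl` is the even half of `ℂ^{n|n}`. -/
abbrev SMat (n : ℕ) : Type := Matrix (Fin n ⊕ Fin n) (Fin n ⊕ Fin n) ℂ

/-- The sign `(-1)^p`, for a parity `p`. -/
def sgn (p : ZMod 2) : ℂ := (-1) ^ p.val

/-- Sign of a row or column index: `1` on the even half, `-1` on the odd half. -/
def halfSign {n : ℕ} : Fin n ⊕ Fin n → ℂ := Sum.elim (fun _ => 1) (fun _ => -1)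

/-- The parity automorphism of `gl(n|n)`: it fixes the two diagonal blocks and changes the sign
of the two off-diagonal blocks. -/
def parity (n : ℕ) : SMat n →ₗ[ℂ] SMat n where
  toFun x := Matrix.of fun a b => halfSign a * halfSign b * x a b
  map_add' x y := by ext a b; simp [mul_add]
  map_smul' c x := by ext a b; simp; ring

theorem parity_apply {n : ℕ} (x : SMat n) (a b : Fin n ⊕ Fin n) :
    parity n x a b = halfSign a * halfSign b * x a b := rfl

/-- The homogeneous part of parity `p` of `gl(n|n)`: block diagonal matrices for `p = 0`,
block off-diagonal ones for `p = 1`. -/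
def part (n : ℕ) (p : ZMod 2) : Submodule ℂ (SMat n) where
  carrier := {x | parity n x = sgn p • x}
  add_mem' hx hy := by simp_all
  zero_mem' := by simp
  smul_mem' c x hx := by
    simp only [Set.mem_ofPred_eq] at hx ⊢
    rw [map_smul, hx, smul_comm]

/-- A Lie sub-superalgebra of `gl(n|n)`: a graded subspace closed under the superbracket
`[x, y] = x y - (-1)^{|x||y|} y x`. -/
structure SubLie (n : ℕ) where
  carrier : Submodule ℂ (SMat n)
  parity_mem : ∀ x ∈ carrier, parity n x ∈ carrier
  bracket_mem : ∀ (p q : ZMod 2) (x y : SMat n), x ∈ carrier → x ∈ part n p →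
    y ∈ carrier → y ∈ part n q → x * y - sgn (p * q) • (y * x) ∈ carrier

variable {n : ℕ}

/-- The defining relations of the enveloping superalgebra:
`x y - (-1)^{|x||y|} y x = [x, y]` for homogeneous `x`, `y`. -/
inductive EnvRel (L : SubLie n) :
    TensorAlgebra ℂ L.carrier → TensorAlgebra ℂ L.carrier → Prop
  | bracket (p q : ZMod 2) (x y : L.carrier) (hx : (x : SMat n) ∈ part n p)
      (hy : (y : SMat n) ∈ part n q) :
      EnvRel L
        (TensorAlgebra.ι ℂ x * TensorAlgebra.ι ℂ y -
          sgn (p * q) • (TensorAlgebra.ι ℂ y * TensorAlgebra.ι ℂ x))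
        (TensorAlgebra.ι ℂ (⟨(x : SMat n) * y - sgn (p * q) • ((y : SMat n) * x),
          L.bracket_mem p q x y x.2 hx y.2 hy⟩ : L.carrier))

/-- The universal enveloping superalgebra `U(L)`. -/
def Env (L : SubLie n) : Type := RingQuot (EnvRel L)

instance (L : SubLie n) : Ring (Env L) := inferInstanceAs (Ring (RingQuot (EnvRel L)))

instance (L : SubLie n) : Algebra ℂ (Env L) :=
  inferInstanceAs (Algebra ℂ (RingQuot (EnvRel L)))

/-- The canonical map `L → U(L)`. -/
def Env.ι (L : SubLie n) : L.carrier →ₗ[ℂ] Env L :=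
  (RingQuot.mkAlgHom ℂ (EnvRel L)).toLinearMap ∘ₗ TensorAlgebra.ι ℂ

/-- The universal property of `U(L)`. -/
def Env.lift (L : SubLie n) {A : Type*} [Ring A] [Algebra ℂ A] (f : L.carrier →ₗ[ℂ] A)
    (hf : ∀ (p q : ZMod 2) (x y : L.carrier) (hx : (x : SMat n) ∈ part n p)
      (hy : (y : SMat n) ∈ part n q),
      f x * f y - sgn (p * q) • (f y * f x) =
        f ⟨(x : SMat n) * y - sgn (p * q) • ((y : SMat n) * x),
          L.bracket_mem p q x y x.2 hx y.2 hy⟩) :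
    Env L →ₐ[ℂ] A :=
  RingQuot.liftAlgHom ℂ ⟨TensorAlgebra.lift ℂ f, by
    rintro _ _ ⟨p, q, x, y, hx, hy⟩
    simpa using hf p q x y hx hy⟩

theorem Env.lift_ι (L : SubLie n) {A : Type*} [Ring A] [Algebra ℂ A] (f : L.carrier →ₗ[ℂ] A)
    (hf) (x : L.carrier) : Env.lift L f hf (Env.ι L x) = f x := by
  simp only [Env.lift, Env.ι]
  erw [RingQuot.liftAlgHom_mkAlgHom_apply]
  simp

theorem Env.bracket (L : SubLie n) (p q : ZMod 2) (x y : L.carrier) (hx : (x : SMat n) ∈ part n p)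
    (hy : (y : SMat n) ∈ part n q) :
    Env.ι L x * Env.ι L y - sgn (p * q) • (Env.ι L y * Env.ι L x) =
      Env.ι L ⟨(x : SMat n) * y - sgn (p * q) • ((y : SMat n) * x),
          L.bracket_mem p q x y x.2 hx y.2 hy⟩ := by
  have h := RingQuot.mkAlgHom_rel ℂ (EnvRel.bracket (L := L) p q x y hx hy)
  rw [map_sub, map_smul, map_mul, map_mul] at h
  exact h

/-- The homomorphism `U(L) → U(L')` induced by a homomorphism `L → L'` of Lie superalgebras
(a linear map that preserves parity and the superbracket). -/
def Env.map (L L' : SubLie n) (f : L.carrier →ₗ[ℂ] L'.carrier)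
    (hpar : ∀ (p : ZMod 2) (x : L.carrier), (x : SMat n) ∈ part n p → (f x : SMat n) ∈ part n p)
    (hbr : ∀ (p q : ZMod 2) (x y : L.carrier) (hx : (x : SMat n) ∈ part n p)
      (hy : (y : SMat n) ∈ part n q),
      (f x : SMat n) * f y - sgn (p * q) • ((f y : SMat n) * f x) =
        f ⟨(x : SMat n) * y - sgn (p * q) • ((y : SMat n) * x),
          L.bracket_mem p q x y x.2 hx y.2 hy⟩) :
    Env L →ₐ[ℂ] Env L' :=
  Env.lift L (Env.ι L' ∘ₗ f) (by
    intro p q x y hx hy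
    simp only [LinearMap.comp_apply]
    rw [Env.bracket L' p q (f x) (f y) (hpar p x hx) (hpar q y hy)]
    exact congrArg _ (Subtype.ext (hbr p q x y hx hy)))

theorem halfSign_mul_self (a : Fin n ⊕ Fin n) : halfSign a * halfSign a = 1 := by
  cases a <;> simp [halfSign]

theorem parity_mul (x y : SMat n) : parity n (x * y) = parity n x * parity n y := by
  ext a b
  simp only [parity_apply, Matrix.mul_apply, Finset.mul_sum]
  refine Finset.sum_congr rfl fun c _ => ?_
  linear_combination (-(halfSign a * halfSign b * x a c * y c b)) * halfSign_mul_self c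

theorem parity_part {p : ZMod 2} {x : SMat n} (hx : x ∈ part n p) : parity n x ∈ part n p := by
  change parity n x = sgn p • x at hx
  change parity n (parity n x) = sgn p • parity n x
  rw [hx, map_smul, hx]

/-- The parity automorphism of `U(L)`: `u ↦ (-1)^{|u|} u` on homogeneous elements. -/
def Env.parity (L : SubLie n) : Env L →ₐ[ℂ] Env L :=
  Env.map L L ((QueerW.parity n).restrict L.parity_mem) (fun _ _ hx => parity_part hx) (by
    intro p q x y hx hy
    simp [LinearMap.restrict_apply, parity_mul])

/-- The homogeneous part of parity `p` of `U(L)`. -/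
def Env.part (L : SubLie n) (p : ZMod 2) : Submodule ℂ (Env L) where
  carrier := {u | Env.parity L u = sgn p • u}
  add_mem' hx hy := by simp_all
  zero_mem' := by simp
  smul_mem' c x hx := by
    simp only [Set.mem_ofPred_eq] at hx ⊢
    rw [map_smul, hx, smul_comm]

/-- The adjoint action on `U(L)` of an element `x ∈ L` of parity `p`:
`ad(x) y = x y - (-1)^{p|y|} y x` for homogeneous `y`, extended linearly in `y`. -/
def Env.ad (L : SubLie n) (p : ZMod 2) (x : L.carrier) (y : Env L) : Env L :=
  Env.ι L x * y - ((Env.parity L)^[p.val] y) * Env.ι L x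

/-! ### `Q(n)` and its triangular decomposition -/

/-- The matrices with blocks `(A B; B A)`, where `A` and `B` are supported on the positions
`(i, j)` with `S i j`. For a transitive relation `S` it is a Lie superalgebra. -/
def queer (n : ℕ) (S : Fin n → Fin n → Prop) (hS : ∀ i j k, S i j → S j k → S i k) :
    SubLie n where
  carrier :=
    { carrier := {x | ∀ i j, x (.inl i) (.inl j) = x (.inr i) (.inr j) ∧
        x (.inl i) (.inr j) = x (.inr i) (.inl j) ∧
        (¬ S i j → x (.inl i) (.inl j) = 0 ∧ x (.inl i) (.inr j) = 0)}
      add_mem' := by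
        intro x y hx hy i j
        obtain ⟨h1, h2, h3⟩ := hx i j
        obtain ⟨k1, k2, k3⟩ := hy i j
        refine ⟨by simp [h1, k1], by simp [h2, k2], fun h => ?_⟩
        simp [h3 h, k3 h]
      zero_mem' := by intro i j; simp
      smul_mem' := by
        intro c x hx i j
        obtain ⟨h1, h2, h3⟩ := hx i j
        refine ⟨by simp [h1], by simp [h2], fun h => ?_⟩
        simp [h3 h] }
  parity_mem := by
    intro x hx i j
    obtain ⟨h1, h2, h3⟩ := hx i j
    refine ⟨by simp [parity_apply, halfSign, h1], by simp [parity_apply, halfSign, h2], fun h => ?_⟩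
    simp [parity_apply, halfSign, h3 h]
  bracket_mem := by
    have key : ∀ x y : SMat n,
        (∀ i j, x (.inl i) (.inl j) = x (.inr i) (.inr j) ∧
          x (.inl i) (.inr j) = x (.inr i) (.inl j) ∧
          (¬ S i j → x (.inl i) (.inl j) = 0 ∧ x (.inl i) (.inr j) = 0)) →
        (∀ i j, y (.inl i) (.inl j) = y (.inr i) (.inr j) ∧
          y (.inl i) (.inr j) = y (.inr i) (.inl j) ∧
          (¬ S i j → y (.inl i) (.inl j) = 0 ∧ y (.inl i) (.inr j) = 0)) →
        (∀ i j, (x * y) (.inl i) (.inl j) = (x * y) (.inr i) (.inr j) ∧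
          (x * y) (.inl i) (.inr j) = (x * y) (.inr i) (.inl j) ∧
          (¬ S i j → (x * y) (.inl i) (.inl j) = 0 ∧ (x * y) (.inl i) (.inr j) = 0)) := by
      intro x y hx hy i j
      simp only [Matrix.mul_apply, Fintype.sum_sum_type]
      refine ⟨?_, ?_, fun h => ?_⟩
      · rw [add_comm]
        congr 1 <;> refine Finset.sum_congr rfl fun k _ => ?_
        · rw [(hx i k).2.1, (hy k j).2.1]
        · rw [(hx i k).1, (hy k j).1]
      · rw [add_comm]
        congr 1 <;> refine Finset.sum_congr rfl fun k _ => ?_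
        · rw [(hx i k).2.1, (hy k j).1]
        · rw [(hx i k).1, (hy k j).2.1]
      · have hk : ∀ k, ¬ S i k ∨ ¬ S k j := by
          intro k
          by_contra! hc
          exact h (hS _ _ _ hc.1 hc.2)
        have e : ∀ k, x (.inl i) (.inl k) * y (.inl k) (.inl j) = 0 ∧
            x (.inl i) (.inr k) * y (.inr k) (.inl j) = 0 ∧
            x (.inl i) (.inl k) * y (.inl k) (.inr j) = 0 ∧
            x (.inl i) (.inr k) * y (.inr k) (.inr j) = 0 := by
          intro k
          rw [← (hy k j).1, ← (hy k j).2.1]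
          rcases hk k with h | h
          · simp [(hx i k).2.2 h]
          · simp [(hy k j).2.2 h]
        constructor
        · simp [fun k => (e k).1, fun k => (e k).2.1]
        · simp [fun k => (e k).2.2.1, fun k => (e k).2.2.2]
    intro p q x y hx _ hy _
    exact Submodule.sub_mem _ (key x y hx hy) (Submodule.smul_mem _ _ (key y x hy hx))

/-- The queer Lie superalgebra `Q(n)`. -/
def gAlg (n : ℕ) : SubLie n := queer n (fun _ _ => True) (fun _ _ _ _ _ => trivial)

/-- The Cartan subalgebra: `A` and `B` diagonal. -/
def hAlg (n : ℕ) : SubLie n := queer n (fun i j => i = j) (fun _ _ _ => Eq.trans)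

/-- The Borel subalgebra: `A` and `B` upper triangular. -/
def bAlg (n : ℕ) : SubLie n := queer n (fun i j => i ≤ j) (fun _ _ _ => le_trans)

/-- The nilpotent subalgebra: `A` and `B` strictly lower triangular. -/
def nMinus (n : ℕ) : SubLie n := queer n (fun i j => j < i) (fun _ _ _ h₁ h₂ => h₂.trans h₁)

theorem queer_le_gAlg {S : Fin n → Fin n → Prop} {hS} :
    (queer n S hS).carrier ≤ (gAlg n).carrier :=
  fun _ hx i j => ⟨(hx i j).1, (hx i j).2.1, fun h => absurd trivial h⟩

/-- The inclusion `U(b) → U(g)`. -/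
def incl (n : ℕ) : Env (bAlg n) →ₐ[ℂ] Env (gAlg n) :=
  Env.map (bAlg n) (gAlg n) (Submodule.inclusion queer_le_gAlg) (fun _ _ hx => hx)
    (fun _ _ _ _ _ _ => rfl)

/-- Underlying position in `{1, …, n}` of a row or column index. -/
def pos : Fin n ⊕ Fin n → Fin n := Sum.elim id id

/-- The map that keeps the diagonals of the four blocks and kills all other entries. -/
def diagPart (n : ℕ) : SMat n →ₗ[ℂ] SMat n where
  toFun x := Matrix.of fun a c => if pos a = pos c then x a c else 0
  map_add' x y := by ext a c; by_cases h : pos a = pos c <;> simp [h]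
  map_smul' r x := by ext a c; by_cases h : pos a = pos c <;> simp [h]

theorem diagPart_apply (x : SMat n) (a c : Fin n ⊕ Fin n) :
    diagPart n x a c = if pos a = pos c then x a c else 0 := rfl

theorem diagPart_mem (x : SMat n) (hx : x ∈ (bAlg n).carrier) : diagPart n x ∈ (hAlg n).carrier := by
  intro i j
  obtain ⟨h1, h2, -⟩ := hx i j
  by_cases hij : i = j <;> simp_all [diagPart_apply, pos]

theorem diagPart_part {p : ZMod 2} {x : SMat n} (hx : x ∈ part n p) :
    diagPart n x ∈ part n p := by
  change parity n x = sgn p • x at hx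
  change parity n _ = sgn p • _
  ext a c
  have := congrFun (congrFun hx a) c
  by_cases hac : pos a = pos c <;> simp_all [diagPart_apply, parity_apply]

theorem b_apply_eq_zero {x : SMat n} (hx : x ∈ (bAlg n).carrier) {a c : Fin n ⊕ Fin n}
    (hac : ¬ pos a ≤ pos c) : x a c = 0 := by
  rcases a with i | i <;> rcases c with j | j <;> simp only [pos, Sum.elim_inl, Sum.elim_inr,
    id] at hac
  · exact ((hx i j).2.2 hac).1
  · exact ((hx i j).2.2 hac).2
  · rw [← (hx i j).2.1]; exact ((hx i j).2.2 hac).2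
  · rw [← (hx i j).1]; exact ((hx i j).2.2 hac).1

theorem diagPart_mul {x y : SMat n} (hx : x ∈ (bAlg n).carrier) (hy : y ∈ (bAlg n).carrier) :
    diagPart n (x * y) = diagPart n x * diagPart n y := by
  ext a c
  simp only [diagPart_apply, Matrix.mul_apply]
  by_cases hac : pos a = pos c
  · rw [if_pos hac]
    refine Finset.sum_congr rfl fun d _ => ?_
    by_cases had : pos a = pos d
    · rw [if_pos had, if_pos (had.symm.trans hac)]
    · rw [if_neg had, zero_mul]
      by_cases h1 : pos a ≤ pos d
      · have h2 : ¬ pos d ≤ pos c := fun h2 => had (le_antisymm h1 (hac ▸ h2))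
        rw [b_apply_eq_zero hy h2, mul_zero]
      · rw [b_apply_eq_zero hx h1, zero_mul]
  · rw [if_neg hac]
    symm
    refine Finset.sum_eq_zero fun d _ => ?_
    by_cases had : pos a = pos d
    · rw [if_neg (fun h2 => hac (had.trans h2)), mul_zero]
    · rw [if_neg had, zero_mul]

/-- The Harish-Chandra homomorphism `ϑ : U(b) → U(h)`: the algebra homomorphism induced by the
projection `b = n⁺ ⊕ h → h` that kills the ideal `n⁺` (strictly upper triangular `A`, `B`);
its kernel is `n⁺ U(b)`. -/
def harishChandra (n : ℕ) : Env (bAlg n) →ₐ[ℂ] Env (hAlg n) :=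
  Env.map (bAlg n) (hAlg n) ((diagPart n).restrict diagPart_mem) (fun _ _ hx => diagPart_part hx) (by
    intro p q x y hx hy
    simp [LinearMap.restrict_apply, diagPart_mul x.2 y.2, diagPart_mul y.2 x.2])

/-! ### The principal finite `W`-algebra -/

/-- The functional `φ` with `φ(e_{i,j}) = δ_{i,j+1}` and `φ(f_{i,j}) = 0`. -/
def phi (n : ℕ) (x : SMat n) : ℂ :=
  ∑ i : Fin n, ∑ j : Fin n, if (i : ℕ) = j + 1 then x (.inl i) (.inl j) else 0

/-- The left ideal `I_φ` of `U(g)` generated by `x - φ(x)` for `x ∈ n⁻`. -/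
def whittakerIdeal (n : ℕ) : Ideal (Env (gAlg n)) :=
  Ideal.span {u | ∃ (x : SMat n) (hx : x ∈ (nMinus n).carrier),
    u = Env.ι (gAlg n) ⟨x, queer_le_gAlg hx⟩ - algebraMap ℂ _ (phi n x)}

theorem mul_mem_whittakerIdeal {u v : Env (gAlg n)} (hu : u ∈ whittakerIdeal n)
    (hv : ∀ (p : ZMod 2) (x : SMat n) (hx : x ∈ (nMinus n).carrier), x ∈ part n p →
      Env.ad (gAlg n) p ⟨x, queer_le_gAlg hx⟩ v ∈ whittakerIdeal n) :
    u * v ∈ whittakerIdeal n := by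
  refine Submodule.span_induction (p := fun u _ => u * v ∈ whittakerIdeal n) ?_ ?_ ?_ ?_ hu
  · rintro _ ⟨x, hx, rfl⟩
    have hP := (nMinus n).parity_mem x hx
    have hPP : parity n (parity n x) = x := by
      ext a c
      simp only [parity_apply]
      linear_combination (x a c * halfSign c * halfSign c) * halfSign_mul_self a +
        x a c * halfSign_mul_self c
    obtain ⟨y, hy⟩ : ∃ y, y = (1 / 2 : ℂ) • (x + parity n x) := ⟨_, rfl⟩
    obtain ⟨z, hz⟩ : ∃ z, z = (1 / 2 : ℂ) • (x - parity n x) := ⟨_, rfl⟩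
    have hym : y ∈ (nMinus n).carrier :=
      hy ▸ Submodule.smul_mem _ _ (Submodule.add_mem _ hx hP)
    have hzm : z ∈ (nMinus n).carrier :=
      hz ▸ Submodule.smul_mem _ _ (Submodule.sub_mem _ hx hP)
    have hyp : y ∈ part n 0 := by
      change parity n y = sgn 0 • y
      rw [hy, map_smul, map_add, hPP]
      simp [sgn, add_comm]
    have hzp : z ∈ part n 1 := by
      change parity n z = sgn 1 • z
      rw [hz, map_smul, map_sub, hPP]
      simp [sgn, ZMod.val_one, ← smul_neg]
    have hxyz : x = y + z := by
      rw [hy, hz]; ext a c; simp; ring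
    have hphiz : phi n z = 0 := by
      simp [phi, hz, parity_apply, halfSign]
    have hphi : phi n x = phi n y := by
      simp only [phi, hy, parity_apply, halfSign, Matrix.smul_apply, Matrix.add_apply,
        Sum.elim_inl]
      refine Finset.sum_congr rfl fun i _ => Finset.sum_congr rfl fun j _ => ?_
      split_ifs
      · simp; ring
      · rfl
    have h0 := hv 0 y hym hyp
    have h1 := hv 1 z hzm hzp
    have gy : Env.ι (gAlg n) ⟨y, queer_le_gAlg hym⟩ - algebraMap ℂ _ (phi n y) ∈
        whittakerIdeal n := Submodule.subset_span ⟨y, hym, rfl⟩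
    have gz : Env.ι (gAlg n) ⟨z, queer_le_gAlg hzm⟩ - algebraMap ℂ _ (phi n z) ∈
        whittakerIdeal n := Submodule.subset_span ⟨z, hzm, rfl⟩
    have hι : Env.ι (gAlg n) ⟨x, queer_le_gAlg hx⟩ =
        Env.ι (gAlg n) ⟨y, queer_le_gAlg hym⟩ + Env.ι (gAlg n) ⟨z, queer_le_gAlg hzm⟩ := by
      rw [← map_add]
      exact congrArg _ (Subtype.ext hxyz)
    rw [hphiz, map_zero, sub_zero] at gz
    have hsum := add_mem (add_mem h0 h1) (add_mem (Ideal.mul_mem_left _ v gy)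
      (Ideal.mul_mem_left _ (Env.parity (gAlg n) v) gz))
    convert hsum using 1
    rw [hι, hphi]
    simp only [Env.ad, ZMod.val_zero, ZMod.val_one, Function.iterate_zero, Function.iterate_one,
      id, mul_sub, sub_mul, add_mul]
    rw [Algebra.commutes (phi n y) v]
    abel
  · simp
  · intro u u' _ _ h1 h2
    rw [add_mul]
    exact add_mem h1 h2
  · intro r u _ h1
    rw [smul_eq_mul, mul_assoc]
    exact Ideal.mul_mem_left _ r h1

/-- The principal finite `W`-algebra of `Q(n)`. Every class in `U(g)/I_φ` has exactly one
representative in `U(b)`, because `U(g)/I_φ ≅ U(b) ⊗ ℂ_φ`; through this identification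
`W = {y mod I_φ | ad(x) y ∈ I_φ for all x ∈ n⁻}` is a subalgebra of `U(b)`. -/
def W (n : ℕ) : Subalgebra ℂ (Env (bAlg n)) where
  carrier := {y | ∀ (p : ZMod 2) (x : SMat n) (hx : x ∈ (nMinus n).carrier), x ∈ part n p →
    Env.ad (gAlg n) p ⟨x, queer_le_gAlg hx⟩ (incl n y) ∈ whittakerIdeal n}
  mul_mem' := by
    intro u v hu hv p x hx hxp
    have h1 := mul_mem_whittakerIdeal (hu p x hx hxp) hv
    have h2 := Ideal.mul_mem_left _ ((Env.parity (gAlg n))^[p.val] (incl n u)) (hv p x hx hxp)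
    convert add_mem h1 h2 using 1
    rw [map_mul, Env.ad, Env.ad, Env.ad, iterate_map_mul]
    noncomm_ring
  add_mem' := by
    intro u v hu hv p x hx hxp
    convert add_mem (hu p x hx hxp) (hv p x hx hxp) using 1
    rw [map_add, Env.ad, Env.ad, Env.ad, iterate_map_add]
    noncomm_ring
  algebraMap_mem' := by
    intro r p x hx hxp
    have : (Env.parity (gAlg n))^[p.val] (algebraMap ℂ _ r) = algebraMap ℂ _ r :=
      Function.iterate_fixed (AlgHom.commutes _ r) _
    rw [AlgHom.commutes, Env.ad, this, Algebra.commutes, sub_self]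
    exact Submodule.zero_mem _

/-- The homogeneous part of parity `p` of `W`. -/
def W.part (n : ℕ) (p : ZMod 2) : Submodule ℂ (W n) :=
  (Env.part (bAlg n) p).comap (W n).val.toLinearMap

/-! ### Supermodules -/

/-- `V = V₀ ⊕ V₁`, with action `ρ`, is a supermodule over the superalgebra `A = A₀ ⊕ A₁`, and it
is simple: it is non-zero and has no graded submodules other than `0` and `V`. -/
structure IsSimpleSupermodule {A V : Type*} [Ring A] [Algebra ℂ A] [AddCommGroup V] [Module ℂ V]
    (𝒜 : ZMod 2 → Submodule ℂ A) (𝒱 : ZMod 2 → Submodule ℂ V)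
    (ρ : A →ₐ[ℂ] Module.End ℂ V) : Prop where
  internal : DirectSum.IsInternal 𝒱
  graded : ∀ (p q : ZMod 2), ∀ a ∈ 𝒜 p, ∀ v ∈ 𝒱 q, ρ a v ∈ 𝒱 (p + q)
  nontrivial : Nontrivial V
  simple : ∀ N : Submodule ℂ V, N = ⨆ p, N ⊓ 𝒱 p → (∀ a, ∀ v ∈ N, ρ a v ∈ N) → N = ⊥ ∨ N = ⊤

/-- The matrix `e_{i,i}` in the Cartan subalgebra. -/
def eDiag (i : Fin n) : (hAlg n).carrier :=
  ⟨Matrix.diagonal fun a => if pos a = i then 1 else 0, by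
    intro j k
    by_cases hjk : j = k
    · subst hjk; simp [pos]; rfl
    · simp [pos, hjk]⟩

/-- The element `x_i = e_{i,i}` of `U(h)`. -/
def xElt (i : Fin n) : Env (hAlg n) := Env.ι (hAlg n) (eDiag i)

/-- `V` is the simple `U(h)`-supermodule `V(s)` or `Π V(s)`: a simple `U(h)`-supermodule on which
every `x_i` acts as the scalar `s_i`, that is, a simple graded module over the Clifford
superalgebra `C_s = U(h)/(x_i - s_i)`. -/
structure IsVs {V : Type*} [AddCommGroup V] [Module ℂ V] (s : Fin n → ℂ)
    (𝒱 : ZMod 2 → Submodule ℂ V) (ρ : Env (hAlg n) →ₐ[ℂ] Module.End ℂ V) : Prop where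
  simple : IsSimpleSupermodule (Env.part (hAlg n)) 𝒱 ρ
  weight : ∀ i, ρ (xElt i) = algebraMap ℂ _ (s i)

/-- `s` is typical: `s_i + s_j ≠ 0` for all `i ≠ j`. -/
def Typical (s : Fin n → ℂ) : Prop := ∀ i j, i ≠ j → s i + s j ≠ 0

/-- The restriction to `W` of an action `ρ` of `U(h)`, along `W → U(h)` given by the
Harish-Chandra homomorphism. -/
def resW {V : Type*} [AddCommGroup V] [Module ℂ V] (ρ : Env (hAlg n) →ₐ[ℂ] Module.End ℂ V) :
    W n →ₐ[ℂ] Module.End ℂ V :=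
  ρ.comp ((harishChandra n).comp (W n).val)

end QueerW

end

noncomputable section

namespace QueerW

variable {n : ℕ}

set_option linter.unusedSectionVars false

/-! ### Nondegeneracy of the Krylov space -/

/-! Two elements of `W` already suffice. Modulo the `x_i`, which act on `V(s)` as scalars, the
Harish-Chandra images of `oddElt` and `evenElt` act as `Θ = ∑ η_i` and, up to an additive scalar, `q
= ∑_{j<i} η_i η_j`, where `η_i = (-1)^i ξ_i` satisfy the Clifford relations `η_i η_j + η_j η_i = 2
δ_{ij} s_i`.

Let `N` be a graded subspace stable under `W`, and let `L` be the space of vectors `c` for which `∑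
c_i η_i` preserves `N`. It contains `(1, …, 1)` because of `Θ`. Commutation with `q` sends the
operator of `c` to twice that of `signOp s c` (`commutator_eq_signOp`), so `L` is stable under
`signOp s`. Typicality forces such an `L` to be everything (`eq_top_of_signOp_invariant`). Hence
every `ξ_i` preserves `N`, so `N` is a `U(h)`-submodule and is `0` or `V`.

Membership of the two elements in `W` is a statement about Whittaker vectors: by
`mem_W_of_isWhittaker` it is enough that they send the generator of `U(g)/I_φ` to a vector on which
the simple root vectors of `n⁻` act through `φ`. Both preserve this property in every `U(g)`-module.
-/

/-- The operator `c ↦ (∑ₖ sgn(i - k) sₖ cₖ)ᵢ` on `ℂⁿ`. -/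
def signOp (s : Fin n → ℂ) : Module.End ℂ (Fin n → ℂ) where
  toFun c i := ∑ k, ((if k < i then s k * c k else 0) - (if i < k then s k * c k else 0))
  map_add' c d := by
    ext i
    simp only [Pi.add_apply, ← Finset.sum_add_distrib]
    refine Finset.sum_congr rfl fun k _ => ?_
    split_ifs <;> ring
  map_smul' r c := by
    ext i
    simp only [Pi.smul_apply, smul_eq_mul, RingHom.id_apply, Finset.mul_sum]
    refine Finset.sum_congr rfl fun k _ => ?_
    split_ifs <;> ring

theorem signOp_apply (s c : Fin n → ℂ) (i : Fin n) :
    signOp s c i = ∑ k, ((if k < i then s k * c k else 0) - (if i < k then s k * c k else 0)) :=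
  rfl

/-- A two-sided boundary value problem for a first order recursion has only the zero solution
when `s i + s j ≠ 0` for `i < j`. -/
theorem recursion_eq_zero {n : ℕ} (s : ℕ → ℂ) (hs : ∀ i j, i < j → j < n → s i + s j ≠ 0)
    (t : ℂ) (P : ℕ → ℂ) (h0 : P 0 = 0) (hn : P n = 0)
    (hP : ∀ k < n, (t + s k) * P (k + 1) = (t - s k) * P k) : ∀ k ≤ n, P k = 0 := by
  -- Vanishing propagates forward from `P 0` until some factor `t + s m` is zero. Beyond such an
  -- `m`, `t - s k = -(s m + s k)` is nonzero, so vanishing propagates backward from `P n` instead.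
  by_cases ht : ∃ m < n, t + s m = 0
  · obtain ⟨m, hm, htm⟩ := ht
    have hlow : ∀ k ≤ n, P k = 0 ∨ ∃ m < k, t + s m = 0 := by
      intro k
      induction k with
      | zero => intro _; exact Or.inl h0
      | succ k ih =>
        intro hk
        by_cases h : t + s k = 0
        · exact Or.inr ⟨k, k.lt_succ_self, h⟩
        · rcases ih (by omega) with h1 | ⟨m, h1, h2⟩
          · left
            have := hP k (by omega)
            rw [h1, mul_zero] at this
            exact (mul_eq_zero.mp this).resolve_left h
          · exact Or.inr ⟨m, by omega, h2⟩
    have hdown : ∀ d ≤ n, P (n - d) = 0 := by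
      intro d
      induction d with
      | zero => intro _; exact hn
      | succ d ih =>
        intro hd
        rcases hlow (n - (d + 1)) (by omega) with h | ⟨m, h1, h2⟩
        · exact h
        · have h3 := hP (n - (d + 1)) (by omega)
          rw [show n - (d + 1) + 1 = n - d by omega, ih (by omega), mul_zero] at h3
          refine (mul_eq_zero.mp h3.symm).resolve_left fun h4 => ?_
          exact hs m (n - (d + 1)) h1 (by omega) (by linear_combination h2 - h4)
    intro k hk
    have := hdown (n - k) (by omega)
    rwa [show n - (n - k) = k by omega] at this
  · push Not at ht
    intro k
    induction k with
    | zero => intro _; exact h0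
    | succ k ih =>
      intro hk
      have := hP k (by omega)
      rw [ih (by omega), mul_zero] at this
      exact (mul_eq_zero.mp this).resolve_left (ht k (by omega))

/-- A proper `L` has a nonzero annihilator, stable under the transpose, which over `ℂ` contains an
eigenvector `a` with some eigenvalue `t`. In terms of the partial sums `P k = a_0 + … + a_{k-1}`,
the eigenvector equation is the recursion of `recursion_eq_zero`. The condition `P n = 0` is
orthogonality to `(1, …, 1)`. -/
theorem eq_top_of_signOp_invariant (s : Fin n → ℂ) (hs : Typical s)
    (L : Submodule ℂ (Fin n → ℂ)) (h1 : (fun _ => 1) ∈ L)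
    (hL : ∀ c ∈ L, signOp s c ∈ L) : L = ⊤ := by
  by_contra hne
  have hA : L.dualAnnihilator ≠ ⊥ := by
    intro h
    exact hne (by rw [← Subspace.dualAnnihilator_dualCoannihilator_eq (W := L), h]; simp)
  have hmaps : ∀ l ∈ L.dualAnnihilator, (signOp s).dualMap l ∈ L.dualAnnihilator := by
    intro l hl
    rw [Submodule.mem_dualAnnihilator] at hl ⊢
    intro c hc
    exact hl _ (hL c hc)
  have : Nontrivial L.dualAnnihilator := Submodule.nontrivial_iff_ne_bot.mpr hA
  obtain ⟨t, ht⟩ := Module.End.exists_eigenvalue ((signOp s).dualMap.restrict hmaps)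
  obtain ⟨⟨l, hl⟩, hev⟩ := ht.exists_hasEigenvector
  have hl0 : l ≠ 0 := fun h => hev.2 (Subtype.ext h)
  have hlt : ∀ c, l (signOp s c) = t * l c := fun c =>
    LinearMap.congr_fun (congrArg Subtype.val hev.apply_eq_smul) c
  set a : Fin n → ℂ := fun i => l (Pi.single i 1) with ha
  have hla : ∀ c, l c = ∑ i, c i * a i := by
    intro c
    conv_lhs => rw [pi_eq_sum_univ' c]
    simp [ha]
  have hsum : ∑ i, a i = 0 := by
    have := (Submodule.mem_dualAnnihilator l).mp hl _ h1
    simpa [hla] using this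
  -- extension by zero to all natural numbers
  let a' : ℕ → ℂ := fun k => if h : k < n then a ⟨k, h⟩ else 0
  let s' : ℕ → ℂ := fun k => if h : k < n then s ⟨k, h⟩ else 0
  let P : ℕ → ℂ := fun k => ∑ i ∈ Finset.range k, a' i
  have hPfin : ∀ k : ℕ, ∑ i : Fin n, (if (i : ℕ) < k then a i else 0) =
      ∑ i ∈ Finset.range n, if i < k then a' i else 0 := by
    intro k
    rw [Finset.sum_range]
    refine Finset.sum_congr rfl fun i _ => ?_
    simp [a']
  have hPlt : ∀ k ≤ n, ∑ i : Fin n, (if (i : ℕ) < k then a i else 0) = P k := by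
    intro k hk
    rw [hPfin, ← Finset.sum_filter]
    refine Finset.sum_congr ?_ fun _ _ => rfl
    ext i
    simp only [Finset.mem_filter, Finset.mem_range]
    omega
  have hPn : P n = 0 := by
    rw [← hPlt n le_rfl]
    simpa using hsum
  -- As the total sum is zero, the tail beyond `k` is minus the partial sum through `k`, hence the
  -- index `k + 1`.
  have hPgt : ∀ k < n, ∑ i : Fin n, (if k < (i : ℕ) then a i else 0) = - P (k + 1) := by
    intro k hk
    rw [← hPlt (k + 1) hk, eq_neg_iff_add_eq_zero, ← Finset.sum_add_distrib]
    refine Eq.trans (Finset.sum_congr rfl fun i _ => ?_) hsum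
    split_ifs <;> first | omega | simp
  have hrec : ∀ k < n, (t + s' k) * P (k + 1) = (t - s' k) * P k := by
    intro k hk
    -- Evaluated on the `k`-th basis vector, the eigenvector equation involves only the sums of `a`
    -- below and above `k`.
    have h := hlt (Pi.single ⟨k, hk⟩ 1)
    have e1 : l (signOp s (Pi.single ⟨k, hk⟩ 1)) = s ⟨k, hk⟩ * (- P (k + 1) - P k) := by
      rw [hla, ← hPgt k hk, ← hPlt k hk.le, ← Finset.sum_sub_distrib, Finset.mul_sum]
      refine Finset.sum_congr rfl fun i _ => ?_
      rw [signOp_apply, Finset.sum_eq_single ⟨k, hk⟩ (fun j _ hj => by simp [hj]) (by simp)]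
      simp only [Pi.single_eq_same, mul_one, Fin.lt_def]
      split_ifs <;> ring
    have e2 : P (k + 1) = P k + a ⟨k, hk⟩ := by
      simp [P, Finset.sum_range_succ, a', hk]
    rw [e1] at h
    change _ = t * a ⟨k, hk⟩ at h
    have e3 : s' k = s ⟨k, hk⟩ := by simp [s', hk]
    rw [e3, e2]
    rw [e2] at h
    linear_combination -h
  have hzero := recursion_eq_zero s' (n := n) (by
    intro i j hij hj
    simpa [s', hj, hij.trans hj] using hs ⟨i, hij.trans hj⟩ ⟨j, hj⟩ (by simp [hij.ne]))
    t P (by simp [P]) hPn hrec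
  apply hl0
  ext i
  have hi := i.2
  have e2 : P (i + 1) = P i + a i := by
    simp [P, Finset.sum_range_succ, a']
  rw [hzero _ hi, hzero _ hi.le] at e2
  simpa [ha] using e2.symm

/-! ### The standard basis of `Q(n)` -/

/-- The even matrix `e_{i,j}`. -/
def eMat (i j : Fin n) : SMat n :=
  Matrix.fromBlocks (Matrix.single i j 1) 0 0 (Matrix.single i j 1)

/-- The odd matrix `f_{i,j}`. -/
def fMat (i j : Fin n) : SMat n :=
  Matrix.fromBlocks 0 (Matrix.single i j 1) (Matrix.single i j 1) 0

theorem single_mul_single_ite (i j k l : Fin n) :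
    (Matrix.single i j 1 * Matrix.single k l 1 : Matrix (Fin n) (Fin n) ℂ) =
      if j = k then Matrix.single i l 1 else 0 := by
  split_ifs with h
  · subst h; simp
  · simp [h]

theorem eMat_mul_eMat (i j k l : Fin n) :
    eMat i j * eMat k l = if j = k then eMat i l else 0 := by
  simp only [eMat, Matrix.fromBlocks_multiply, single_mul_single_ite]
  split_ifs <;> simp

theorem eMat_mul_fMat (i j k l : Fin n) :
    eMat i j * fMat k l = if j = k then fMat i l else 0 := by
  simp only [eMat, fMat, Matrix.fromBlocks_multiply, single_mul_single_ite]
  split_ifs <;> simp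

theorem fMat_mul_eMat (i j k l : Fin n) :
    fMat i j * eMat k l = if j = k then fMat i l else 0 := by
  simp only [eMat, fMat, Matrix.fromBlocks_multiply, single_mul_single_ite]
  split_ifs <;> simp

theorem fMat_mul_fMat (i j k l : Fin n) :
    fMat i j * fMat k l = if j = k then eMat i l else 0 := by
  simp only [eMat, fMat, Matrix.fromBlocks_multiply, single_mul_single_ite]
  split_ifs <;> simp

theorem eMat_mem_part (i j : Fin n) : eMat i j ∈ part n 0 := by
  change parity n _ = sgn 0 • _
  ext (a | a) (c | c) <;> simp [parity_apply, halfSign, sgn, eMat]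

theorem fMat_mem_part (i j : Fin n) : fMat i j ∈ part n 1 := by
  change parity n _ = sgn 1 • _
  ext (a | a) (c | c) <;> simp [parity_apply, halfSign, sgn, fMat, ZMod.val_one]

theorem eMat_mem_queer {S : Fin n → Fin n → Prop} {hS} {i j : Fin n} (h : S i j) :
    eMat i j ∈ (queer n S hS).carrier := by
  intro k l
  refine ⟨by simp [eMat], by simp [eMat], fun hkl => ⟨?_, by simp [eMat]⟩⟩
  have : ¬ (i = k ∧ j = l) := by rintro ⟨rfl, rfl⟩; exact hkl h
  simp [eMat, this]

theorem fMat_mem_queer {S : Fin n → Fin n → Prop} {hS} {i j : Fin n} (h : S i j) :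
    fMat i j ∈ (queer n S hS).carrier := by
  intro k l
  refine ⟨by simp [fMat], by simp [fMat], fun hkl => ⟨by simp [fMat], ?_⟩⟩
  have : ¬ (i = k ∧ j = l) := by rintro ⟨rfl, rfl⟩; exact hkl h
  simp [fMat, this]

theorem queer_eq_sum {S : Fin n → Fin n → Prop} {hS} {x : SMat n}
    (hx : x ∈ (queer n S hS).carrier) :
    x = ∑ i, ∑ j, (x (.inl i) (.inl j) • eMat i j + x (.inl i) (.inr j) • fMat i j) := by
  ext (a | a) (c | c) <;>
  simp [Matrix.sum_apply, eMat, fMat, Matrix.single_apply, ite_and, ← (hx a c).1, ← (hx a c).2.1]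

/-- Induction over the standard basis of `queer n S`. -/
theorem queer_induction {S : Fin n → Fin n → Prop} {hS} (K : Submodule ℂ (SMat n))
    (he : ∀ i j, S i j → eMat i j ∈ K) (hf : ∀ i j, S i j → fMat i j ∈ K) :
    (queer n S hS).carrier ≤ K := by
  intro x hx
  rw [queer_eq_sum hx]
  refine Submodule.sum_mem _ fun i _ => Submodule.sum_mem _ fun j _ => ?_
  by_cases h : S i j
  · exact add_mem (K.smul_mem _ (he i j h)) (K.smul_mem _ (hf i j h))
  · simp [((hx i j).2.2 h).1, ((hx i j).2.2 h).2]

/-! ### Homomorphisms out of the enveloping superalgebra -/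

theorem Env.hom_ext {L : SubLie n} {A : Type*} [Ring A] [Algebra ℂ A] {f g : Env L →ₐ[ℂ] A}
    (h : ∀ x, f (Env.ι L x) = g (Env.ι L x)) : f = g := by
  refine RingQuot.ringQuot_ext' ℂ f g (TensorAlgebra.hom_ext (LinearMap.ext h))

/-- The universal property gives a map from `U(L)` into `K`; followed by the inclusion it fixes the
generators, so it is the identity. -/
theorem Env.induction {L : SubLie n} (K : Subalgebra ℂ (Env L)) (h : ∀ x, Env.ι L x ∈ K) :
    K = ⊤ := by
  let g : Env L →ₐ[ℂ] K := Env.lift L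
    ((Env.ι L).codRestrict (Subalgebra.toSubmodule K) h) (fun p q x y hx hy =>
      Subtype.ext (Env.bracket L p q x y hx hy))
  have : K.val.comp g = AlgHom.id ℂ (Env L) := by
    refine Env.hom_ext fun x => ?_
    exact congrArg Subtype.val (Env.lift_ι L _ _ x)
  rw [eq_top_iff]
  intro u _
  have h2 := AlgHom.congr_fun this u
  simp only [AlgHom.comp_apply, AlgHom.id_apply] at h2
  rw [← h2]
  exact (g u).2

theorem Env.map_ι (L L' : SubLie n) (f : L.carrier →ₗ[ℂ] L'.carrier) (hpar) (hbr)
    (x : L.carrier) : Env.map L L' f hpar hbr (Env.ι L x) = Env.ι L' (f x) :=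
  Env.lift_ι _ _ _ _

theorem Env.parity_ι (L : SubLie n) (x : L.carrier) :
    Env.parity L (Env.ι L x) = Env.ι L ⟨QueerW.parity n x, L.parity_mem x x.2⟩ :=
  Env.map_ι _ _ _ _ _ _

theorem harishChandra_ι (x : (bAlg n).carrier) :
    harishChandra n (Env.ι _ x) = Env.ι (hAlg n) ⟨diagPart n x, diagPart_mem (x : SMat n) x.2⟩ :=
  Env.map_ι _ _ _ _ _ _

theorem incl_ι (x : (bAlg n).carrier) :
    incl n (Env.ι _ x) = Env.ι _ ⟨x, queer_le_gAlg x.2⟩ :=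
  Env.map_ι _ _ _ _ _ _

theorem harishChandra_parity (u : Env (bAlg n)) :
    harishChandra n (Env.parity _ u) = Env.parity _ (harishChandra n u) := by
  have : (harishChandra n).comp (Env.parity _) = (Env.parity _).comp (harishChandra n) := by
    refine Env.hom_ext fun x => ?_
    rw [AlgHom.comp_apply, AlgHom.comp_apply, Env.parity_ι, harishChandra_ι, harishChandra_ι,
      Env.parity_ι]
    refine congrArg (Env.ι _) (Subtype.ext ?_)
    ext a c
    simp [diagPart_apply, parity_apply]
  exact AlgHom.congr_fun this u

theorem harishChandra_mem_part {p : ZMod 2} {u : Env (bAlg n)} (hu : u ∈ Env.part _ p) :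
    harishChandra n u ∈ Env.part _ p := by
  change Env.parity _ u = sgn p • u at hu
  change Env.parity _ _ = sgn p • _
  rw [← harishChandra_parity, hu, map_smul]

/-! ### Whittaker vectors -/

theorem mem_gAlg_eMat (i j : Fin n) : eMat i j ∈ (gAlg n).carrier := eMat_mem_queer trivial

theorem mem_gAlg_fMat (i j : Fin n) : fMat i j ∈ (gAlg n).carrier := fMat_mem_queer trivial

/-- The generator `e_{i,j}` of `U(g)`. -/
def eG (i j : Fin n) : Env (gAlg n) := Env.ι _ ⟨eMat i j, mem_gAlg_eMat i j⟩

/-- The generator `f_{i,j}` of `U(g)`. -/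
def fG (i j : Fin n) : Env (gAlg n) := Env.ι _ ⟨fMat i j, mem_gAlg_fMat i j⟩

/-! ### Supercommutation relations of the matrix units in `U(g)`. -/

theorem eG_mul_eG (i j k l : Fin n) :
    eG i j * eG k l = eG k l * eG i j + (if j = k then eG i l else 0) -
      (if l = i then eG k j else 0) := by
  have h := Env.bracket (gAlg n) 0 0 ⟨_, mem_gAlg_eMat i j⟩ ⟨_, mem_gAlg_eMat k l⟩
    (eMat_mem_part i j) (eMat_mem_part k l)
  have h2 : (⟨eMat i j * eMat k l - sgn (0 * 0) • (eMat k l * eMat i j),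
      (gAlg n).bracket_mem 0 0 _ _ (mem_gAlg_eMat i j) (eMat_mem_part i j) (mem_gAlg_eMat k l)
        (eMat_mem_part k l)⟩ : (gAlg n).carrier) =
      (if j = k then ⟨eMat i l, mem_gAlg_eMat i l⟩ else 0) -
        (if l = i then ⟨eMat k j, mem_gAlg_eMat k j⟩ else 0) := by
    apply Subtype.ext
    simp only [eMat_mul_eMat, sgn]
    split_ifs <;> simp
  rw [h2, map_sub, apply_ite (Env.ι _), apply_ite (Env.ι _), map_zero] at h
  simp only [sgn, mul_zero, ZMod.val_zero, pow_zero, one_smul] at h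
  change eG i j * eG k l - eG k l * eG i j = _ at h
  rw [add_sub_assoc, ← sub_eq_iff_eq_add', h]
  rfl

theorem eG_mul_fG (i j k l : Fin n) :
    eG i j * fG k l = fG k l * eG i j + (if j = k then fG i l else 0) -
      (if l = i then fG k j else 0) := by
  have h := Env.bracket (gAlg n) 0 1 ⟨_, mem_gAlg_eMat i j⟩ ⟨_, mem_gAlg_fMat k l⟩
    (eMat_mem_part i j) (fMat_mem_part k l)
  have h2 : (⟨eMat i j * fMat k l - sgn (0 * 1) • (fMat k l * eMat i j),
      (gAlg n).bracket_mem 0 1 _ _ (mem_gAlg_eMat i j) (eMat_mem_part i j) (mem_gAlg_fMat k l)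
        (fMat_mem_part k l)⟩ : (gAlg n).carrier) =
      (if j = k then ⟨fMat i l, mem_gAlg_fMat i l⟩ else 0) -
        (if l = i then ⟨fMat k j, mem_gAlg_fMat k j⟩ else 0) := by
    apply Subtype.ext
    simp only [eMat_mul_fMat, fMat_mul_eMat, sgn]
    split_ifs <;> simp
  rw [h2, map_sub, apply_ite (Env.ι _), apply_ite (Env.ι _), map_zero] at h
  simp only [sgn, zero_mul, ZMod.val_zero, pow_zero, one_smul] at h
  change eG i j * fG k l - fG k l * eG i j = _ at h
  rw [add_sub_assoc, ← sub_eq_iff_eq_add', h]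
  rfl

theorem fG_mul_eG (i j k l : Fin n) :
    fG i j * eG k l = eG k l * fG i j + (if j = k then fG i l else 0) -
      (if l = i then fG k j else 0) := by
  rw [eG_mul_fG k l i j, sub_add_eq_add_sub]
  simp only [eq_comm (a := j)]
  abel

theorem fG_mul_fG (i j k l : Fin n) :
    fG i j * fG k l = - (fG k l * fG i j) + (if j = k then eG i l else 0) +
      (if l = i then eG k j else 0) := by
  have h := Env.bracket (gAlg n) 1 1 ⟨_, mem_gAlg_fMat i j⟩ ⟨_, mem_gAlg_fMat k l⟩
    (fMat_mem_part i j) (fMat_mem_part k l)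
  have h2 : (⟨fMat i j * fMat k l - sgn (1 * 1) • (fMat k l * fMat i j),
      (gAlg n).bracket_mem 1 1 _ _ (mem_gAlg_fMat i j) (fMat_mem_part i j) (mem_gAlg_fMat k l)
        (fMat_mem_part k l)⟩ : (gAlg n).carrier) =
      (if j = k then ⟨eMat i l, mem_gAlg_eMat i l⟩ else 0) +
        (if l = i then ⟨eMat k j, mem_gAlg_eMat k j⟩ else 0) := by
    apply Subtype.ext
    simp only [fMat_mul_fMat, sgn]
    split_ifs <;> simp [ZMod.val_one]
  rw [h2, map_add, apply_ite (Env.ι _), apply_ite (Env.ι _), map_zero] at h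
  simp only [sgn, mul_one, ZMod.val_one, pow_one, neg_smul, one_smul, sub_neg_eq_add] at h
  change fG i j * fG k l + fG k l * fG i j = _ at h
  rw [add_assoc, neg_add_eq_sub, eq_sub_iff_add_eq, h]
  rfl

theorem phi_eMat (i j : Fin n) : phi n (eMat i j) = if (i : ℕ) = j + 1 then 1 else 0 := by
  rw [phi, Finset.sum_eq_single i, Finset.sum_eq_single j]
  · simp [eMat]
  · intro b _ hb; simp [eMat, hb.symm]
  · simp
  · intro b _ hb; simp [eMat, hb.symm]
  · simp

theorem phi_fMat (i j : Fin n) : phi n (fMat i j) = 0 := by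
  simp [phi, fMat]

/-- `phi` as a linear map. -/
def phiₗ (n : ℕ) : SMat n →ₗ[ℂ] ℂ where
  toFun := phi n
  map_add' x y := by
    simp only [phi, ← Finset.sum_add_distrib]
    refine Finset.sum_congr rfl fun i _ => Finset.sum_congr rfl fun j _ => ?_
    split_ifs <;> simp
  map_smul' c x := by
    simp only [phi, smul_eq_mul, RingHom.id_apply, Finset.mul_sum]
    refine Finset.sum_congr rfl fun i _ => Finset.sum_congr rfl fun j _ => ?_
    split_ifs <;> simp

variable {M : Type*} [AddCommGroup M] [Module ℂ M] [Module (Env (gAlg n)) M]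
  [IsScalarTower ℂ (Env (gAlg n)) M]

variable (n) in
/-- A vector on which the simple root vectors of `n⁻` act through `φ`. -/
structure IsWhittaker (v : M) : Prop where
  even : ∀ i j : Fin n, (i : ℕ) = j + 1 → eG i j • v = v
  odd : ∀ i j : Fin n, (i : ℕ) = j + 1 → fG i j • v = 0

/-- Induction on the height `i - j`: a non-simple root vector is the commutator of `e_{i,i-1}` with
a root vector of smaller height. Both act on `v` by scalars, so their commutator kills `v`, in
agreement with `φ`. -/
theorem IsWhittaker.smul_eq {v : M} (hv : IsWhittaker n v) (i j : Fin n) (hij : j < i) :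
    eG i j • v = (if (i : ℕ) = j + 1 then v else 0) ∧ fG i j • v = 0 := by
  obtain ⟨d, hd⟩ : ∃ d : ℕ, (i : ℕ) = j + 1 + d := ⟨i - (j + 1), by have := Fin.lt_def.mp hij; omega⟩
  induction d generalizing i with
  | zero => exact ⟨by rw [if_pos hd]; exact hv.even i j hd, hv.odd i j hd⟩
  | succ d ih =>
    have hi := i.2
    let k : Fin n := ⟨j + 1 + d, by omega⟩
    have hkj : j < k := Fin.lt_def.mpr (by simp [k]; omega)
    obtain ⟨h1, h2⟩ := ih k hkj rfl
    have hik : (i : ℕ) = k + 1 := by simp [k, hd]; omega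
    have h3 := hv.even i k hik
    have hji : j ≠ i := hij.ne
    have e1 : eG i j = eG i k * eG k j - eG k j * eG i k := by
      rw [eG_mul_eG i k k j, if_pos rfl, if_neg hji]; abel
    have e2 : fG i j = eG i k * fG k j - fG k j * eG i k := by
      rw [eG_mul_fG i k k j, if_pos rfl, if_neg hji]; abel
    constructor
    · rw [if_neg (by omega), e1, sub_smul, mul_smul, mul_smul, h3, h1]
      split_ifs <;> simp [h3]
    · rw [e2, sub_smul, mul_smul, mul_smul, h3, h2]
      simp

theorem IsWhittaker.ι_smul {v : M} (hv : IsWhittaker n v) (x : SMat n)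
    (hx : x ∈ (nMinus n).carrier) :
    Env.ι (gAlg n) ⟨x, queer_le_gAlg hx⟩ • v = phi n x • v := by
  -- The matrices acting on `v` through `φ` form a kernel, hence a subspace, so testing the matrix
  -- units is enough.
  let K : Submodule ℂ (gAlg n).carrier := LinearMap.ker
    (((LinearMap.toSpanSingleton (Env (gAlg n)) M v).restrictScalars ℂ) ∘ₗ Env.ι (gAlg n) -
      LinearMap.toSpanSingleton ℂ M v ∘ₗ phiₗ n ∘ₗ (gAlg n).carrier.subtype)
  have hK : ∀ y, y ∈ K ↔ Env.ι (gAlg n) y • v = phi n y • v := by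
    intro y
    rw [LinearMap.mem_ker, LinearMap.sub_apply, sub_eq_zero]
    rfl
  have := queer_induction (S := fun i j => j < i) (hS := fun _ _ _ h₁ h₂ => h₂.trans h₁)
    (K.map (gAlg n).carrier.subtype) ?_ ?_ hx
  · obtain ⟨y, hy, rfl⟩ := this
    exact (hK y).mp hy
  · intro i j hij
    refine ⟨⟨_, mem_gAlg_eMat i j⟩, (hK _).mpr ?_, rfl⟩
    change eG i j • v = phi n (eMat i j) • v
    rw [(hv.smul_eq i j hij).1, phi_eMat]
    split_ifs <;> simp
  · intro i j hij
    refine ⟨⟨_, mem_gAlg_fMat i j⟩, (hK _).mpr ?_, rfl⟩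
    change fG i j • v = phi n (fMat i j) • v
    rw [(hv.smul_eq i j hij).2, phi_fMat, zero_smul]

theorem phi_eq_zero_of_odd {x : SMat n} (hx : x ∈ part n 1) : phi n x = 0 := by
  change parity n x = sgn 1 • x at hx
  refine Finset.sum_eq_zero fun i _ => Finset.sum_eq_zero fun j _ => ?_
  have := congrFun (congrFun hx (.inl i)) (.inl j)
  simp only [parity_apply, halfSign, sgn, ZMod.val_one, Sum.elim_inl, Matrix.smul_apply,
    smul_eq_mul] at this
  split_ifs
  · linear_combination this / 2
  · rfl

/-- An element that maps the canonical generator of `U(g)/I_φ` to a Whittaker vector lies in the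
`W`-algebra. -/
theorem mem_W_of_isWhittaker {y : Env (bAlg n)}
    (hy : IsWhittaker n (incl n y • (Submodule.Quotient.mk 1 : Env (gAlg n) ⧸ whittakerIdeal n))) :
    y ∈ W n := by
  intro p x hx hxp
  have h := hy.ι_smul x hx
  have hgen : Env.ι (gAlg n) ⟨x, queer_le_gAlg hx⟩ - algebraMap ℂ _ (phi n x) ∈
      whittakerIdeal n := Submodule.subset_span ⟨x, hx, rfl⟩
  rw [← Submodule.Quotient.mk_smul, ← Submodule.Quotient.mk_smul, ← Submodule.Quotient.mk_smul,
    Submodule.Quotient.eq, smul_eq_mul, smul_eq_mul, mul_one, Algebra.smul_def] at h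
  -- For even `x`, both `x y` and `y x` are congruent to `φ(x) y` modulo `I_φ`. For odd `x`, `φ(x) =
  -- 0` and the two terms of `ad(x) y` lie in `I_φ` separately, whatever the parity of `y`.
  fin_cases p
  · have h2 := Ideal.mul_mem_left _ (incl n y) hgen
    have h3 := sub_mem h h2
    change Env.ι (gAlg n) ⟨x, queer_le_gAlg hx⟩ * incl n y -
      incl n y * Env.ι (gAlg n) ⟨x, queer_le_gAlg hx⟩ ∈ _
    convert h3 using 1
    rw [mul_sub, Algebra.commutes (phi n x) (incl n y)]
    abel
  · rw [phi_eq_zero_of_odd hxp] at h hgen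
    rw [map_zero, sub_zero] at hgen
    rw [map_zero, zero_mul, sub_zero] at h
    exact sub_mem h (Ideal.mul_mem_left _ _ hgen)

theorem isWhittaker_mk_one :
    IsWhittaker n (Submodule.Quotient.mk 1 : Env (gAlg n) ⧸ whittakerIdeal n) := by
  constructor
  · intro i j hij
    have hx : eMat i j ∈ (nMinus n).carrier := eMat_mem_queer (Fin.lt_def.mpr (by omega))
    rw [← Submodule.Quotient.mk_smul, Submodule.Quotient.eq, smul_eq_mul, mul_one]
    refine Submodule.subset_span ⟨_, hx, ?_⟩
    rw [phi_eMat, if_pos hij, map_one]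
    rfl
  · intro i j hij
    have hx : fMat i j ∈ (nMinus n).carrier := fMat_mem_queer (Fin.lt_def.mpr (by omega))
    rw [← Submodule.Quotient.mk_smul, Submodule.Quotient.mk_eq_zero, smul_eq_mul, mul_one]
    refine Submodule.subset_span ⟨_, hx, ?_⟩
    rw [phi_fMat, map_zero, sub_zero]
    rfl

/-! ### Two elements of the principal `W`-algebra -/

/-- The sign `(-1)^i`. -/
def alt (i : Fin n) : ℂ := (-1) ^ (i : ℕ)

theorem alt_mul_self (i : Fin n) : alt i * alt i = 1 := by
  rw [alt, ← mul_pow]; simp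

theorem alt_succ {a b : Fin n} (h : (b : ℕ) = a + 1) : alt b = - alt a := by
  rw [alt, alt, h, pow_succ]; ring

/-- The generator `e_{i,j}` of `U(b)`, for `i ≤ j`. -/
def eB (i j : Fin n) (h : i ≤ j) : Env (bAlg n) := Env.ι _ ⟨eMat i j, eMat_mem_queer h⟩

/-- The generator `f_{i,i}` of `U(b)`. -/
def fB (i : Fin n) : Env (bAlg n) := Env.ι _ ⟨fMat i i, fMat_mem_queer (le_refl i)⟩

/-- The odd element `∑ (-1)ⁱ f_{i,i}`. -/
def oddElt (n : ℕ) : Env (bAlg n) := ∑ i, alt i • fB i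

/-- The quadratic element
`∑_{j < i} (-1)^{i+j} f_{i,i} f_{j,j} - ½ ∑ e_{i,i}² - ∑ e_{i,i+1}`. -/
def evenElt (n : ℕ) : Env (bAlg n) :=
  (∑ i, ∑ j, if j < i then (alt i * alt j) • (fB i * fB j) else 0)
    - (1 / 2 : ℂ) • (∑ i, eB i i le_rfl * eB i i le_rfl)
    - ∑ i : Fin n, ∑ j : Fin n,
      if h : (j : ℕ) = i + 1 then eB i j (Fin.le_def.mpr (by omega)) else 0

theorem incl_eB (i j : Fin n) (h : i ≤ j) : incl n (eB i j h) = eG i j := incl_ι _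

theorem incl_fB (i : Fin n) : incl n (fB i) = fG i i := incl_ι _

theorem incl_oddElt : incl n (oddElt n) = ∑ i, alt i • fG i i := by
  simp [oddElt, map_sum, incl_fB]

theorem incl_evenElt : incl n (evenElt n) =
    (∑ i, ∑ j, if j < i then (alt i * alt j) • (fG i i * fG j j) else 0)
    - (1 / 2 : ℂ) • (∑ i, eG i i * eG i i)
    - ∑ i : Fin n, ∑ j : Fin n, if (j : ℕ) = i + 1 then eG i j else 0 := by
  simp only [evenElt, map_sub, map_sum, map_smul, map_mul, incl_eB, apply_dite (incl n),
    apply_ite (incl n), incl_fB, map_zero, dite_eq_ite]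

/-! ### Simple lowering vectors acting on linear and quadratic expressions. -/

section
variable {v : M} {a b : Fin n}

/-- Here and below, the lowering vector is commuted to the right until it reaches `v`, where it acts
through `φ`; what remains are the commutator terms, which the quadratic formulas evaluate by the
linear ones. -/
theorem eG_smul_fG (hv : IsWhittaker n v) (hab : (b : ℕ) = a + 1) (i : Fin n) :
    eG b a • fG i i • v = fG i i • v := by
  rw [← mul_smul, eG_mul_fG, sub_smul, add_smul, mul_smul, hv.even b a hab]
  split_ifs <;> subst_vars <;> simp [hv.odd _ _ hab]

theorem fG_smul_fG (hv : IsWhittaker n v) (hab : (b : ℕ) = a + 1) (i : Fin n) :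
    fG b a • fG i i • v = ((if i = a then 1 else 0) + (if i = b then 1 else 0) : ℂ) • v := by
  rw [← mul_smul, fG_mul_fG, add_smul, add_smul, neg_smul, mul_smul, hv.odd b a hab, add_smul]
  simp only [eq_comm (a := i)]
  congr 1
  · split_ifs
    · subst_vars; simp [hv.even _ _ hab]
    · simp
  · by_cases h : b = i
    · subst h; simp [hv.even _ _ hab]
    · simp [h]

theorem eG_smul_eG (hv : IsWhittaker n v) (hab : (b : ℕ) = a + 1) (i : Fin n) :
    eG b a • eG i i • v =
      eG i i • v + ((if i = a then 1 else 0) - (if i = b then 1 else 0) : ℂ) • v := by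
  rw [← mul_smul, eG_mul_eG, sub_smul, add_smul, mul_smul, hv.even b a hab, sub_smul, add_sub_assoc]
  congr 2
  · by_cases h : a = i
    · subst h; simp [hv.even _ _ hab]
    · simp [h, Ne.symm h]
  · by_cases h : i = b
    · subst h; simp [hv.even _ _ hab]
    · simp [h]

theorem fG_smul_eG (hv : IsWhittaker n v) (hab : (b : ℕ) = a + 1) (i : Fin n) :
    fG b a • eG i i • v = 0 := by
  rw [← mul_smul, fG_mul_eG, sub_smul, add_smul, mul_smul, hv.odd b a hab]
  split_ifs <;> subst_vars <;> simp [hv.odd _ _ hab]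

theorem eG_smul_fG_fG (hv : IsWhittaker n v) (hab : (b : ℕ) = a + 1) (i j : Fin n) :
    eG b a • fG i i • fG j j • v = fG i i • fG j j • v +
      (((if i = a then 1 else 0) - (if i = b then 1 else 0)) *
        ((if j = a then 1 else 0) + (if j = b then 1 else 0)) : ℂ) • v := by
  rw [← mul_smul, eG_mul_fG, sub_smul, add_smul, mul_smul, eG_smul_fG hv hab, add_sub_assoc,
    mul_smul, sub_smul, ← fG_smul_fG hv hab]
  congr 2
  · by_cases h : a = i
    · subst h; simp
    · simp [h, Ne.symm h]
  · by_cases h : i = b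
    · subst h; simp
    · simp [h]

theorem fG_smul_fG_fG (hv : IsWhittaker n v) (hab : (b : ℕ) = a + 1) (i j : Fin n) :
    fG b a • fG i i • fG j j • v =
      ((if i = a then 1 else 0) + (if i = b then 1 else 0) : ℂ) • fG j j • v -
      ((if j = a then 1 else 0) + (if j = b then 1 else 0) : ℂ) • fG i i • v := by
  have hne : a ≠ b := by rintro rfl; omega
  rw [← mul_smul, fG_mul_fG, add_smul, add_smul, neg_smul, mul_smul, fG_smul_fG hv hab, add_assoc,
    neg_add_eq_sub, smul_comm (fG i i) (_ : ℂ)]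
  congr 1
  by_cases h : i = a
  · subst h; simp [eG_smul_fG hv hab, hne]
  · by_cases h' : i = b
    · subst h'; simp [eG_smul_fG hv hab, h, hne]
    · simp [h, h', Ne.symm h]

theorem eG_smul_eG_eG (hv : IsWhittaker n v) (hab : (b : ℕ) = a + 1) (i : Fin n) :
    eG b a • eG i i • eG i i • v = eG i i • eG i i • v +
      ((if i = a then (2 : ℂ) • eG a a • v + v else 0) +
        (if i = b then v - (2 : ℂ) • eG b b • v else 0)) := by
  have hne : a ≠ b := by rintro rfl; omega
  rw [← mul_smul, eG_mul_eG, sub_smul, add_smul, mul_smul, eG_smul_eG hv hab, smul_add,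
    smul_comm (eG i i) (_ : ℂ)]
  by_cases h : i = a
  · subst h
    simp only [if_true, if_neg hne, eG_smul_eG hv hab, zero_smul]
    generalize eG i i • eG i i • v = u
    generalize eG i i • v = w
    module
  · by_cases h' : i = b
    · subst h'
      simp only [if_true, if_neg hne, if_neg hne.symm, eG_smul_eG hv hab, zero_smul]
      generalize eG i i • eG i i • v = u
      generalize eG i i • v = w
      module
    · simp [h, h', Ne.symm h]

theorem fG_smul_eG_eG (hv : IsWhittaker n v) (hab : (b : ℕ) = a + 1) (i : Fin n) :
    fG b a • eG i i • eG i i • v = 0 := by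
  rw [← mul_smul, fG_mul_eG, sub_smul, add_smul, mul_smul, fG_smul_eG hv hab]
  split_ifs <;> subst_vars <;> simp [fG_smul_eG hv hab]

theorem eG_smul_eG_succ (hv : IsWhittaker n v) (hab : (b : ℕ) = a + 1) (i j : Fin n)
    (hij : (j : ℕ) = i + 1) :
    eG b a • eG i j • v = eG i j • v + if i = a then eG b b • v - eG a a • v else 0 := by
  rw [← mul_smul, eG_mul_eG, sub_smul, add_smul, mul_smul, hv.even b a hab]
  by_cases h : i = a
  · subst h
    obtain rfl : j = b := Fin.ext (by omega)
    simp [add_sub_assoc]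
  · have h2 : j ≠ b := fun h2 => h (Fin.ext (by subst h2; omega))
    simp [h, h2, Ne.symm h]

theorem fG_smul_eG_succ (hv : IsWhittaker n v) (hab : (b : ℕ) = a + 1) (i j : Fin n)
    (hij : (j : ℕ) = i + 1) :
    fG b a • eG i j • v = if i = a then fG b b • v - fG a a • v else 0 := by
  rw [← mul_smul, fG_mul_eG, sub_smul, add_smul, mul_smul, hv.odd b a hab]
  by_cases h : i = a
  · subst h
    obtain rfl : j = b := Fin.ext (by omega)
    simp
  · have h2 : j ≠ b := fun h2 => h (Fin.ext (by subst h2; omega))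
    simp [h, h2, Ne.symm h]

/-- A sum over adjacent positions that is supported on one row. -/
theorem sum_succ_eq (hab : (b : ℕ) = a + 1) (m : M) :
    (∑ i : Fin n, ∑ j : Fin n, if (j : ℕ) = i + 1 then (if i = a then m else 0) else 0) = m := by
  rw [Finset.sum_eq_single a, Finset.sum_eq_single b]
  · simp [hab]
  · intro j _ hj
    exact if_neg fun h => hj (Fin.ext (by omega))
  · simp
  · intro i _ hi
    simp [hi]
  · simp

end

/-! ### Preservation of Whittaker vectors by the two elements. -/

/-- The odd lowering vector `f_{b,a}` contributes `v` from both `f_{a,a}` and `f_{b,b}`; the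
alternating signs make these cancel. -/
theorem IsWhittaker.oddElt_smul {v : M} (hv : IsWhittaker n v) :
    IsWhittaker n (incl n (oddElt n) • v) := by
  rw [incl_oddElt, Finset.sum_smul]
  constructor
  · intro b a hab
    rw [Finset.smul_sum]
    refine Finset.sum_congr rfl fun i _ => ?_
    rw [smul_assoc, smul_comm (eG b a), eG_smul_fG hv hab]
  · intro b a hab
    rw [Finset.smul_sum]
    simp only [smul_assoc, smul_comm (fG b a) (_ : ℂ), fG_smul_fG hv hab, smul_smul]
    rw [← Finset.sum_smul]
    simp [mul_add, Finset.sum_add_distrib, alt_succ hab]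

theorem evenElt_smul (v : M) : incl n (evenElt n) • v =
    (∑ i : Fin n, ∑ j : Fin n, if j < i then ((alt i * alt j) • fG i i • fG j j • v : M) else 0)
    - (1 / 2 : ℂ) • (∑ i : Fin n, eG i i • eG i i • v)
    - ∑ i : Fin n, ∑ j : Fin n, if (j : ℕ) = i + 1 then eG i j • v else 0 := by
  simp only [incl_evenElt, sub_smul, Finset.sum_smul, ite_smul, zero_smul, smul_assoc, mul_smul]

/-- Corrections cancel among the three sums. For `e_{b,a}` they are `v` from the `f f` terms, `-(x_a
- x_b) v - v` from the squares, and `(x_a - x_b) v` from the `e_{i,i+1}`. For `f_{b,a}` the `f f`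
terms give `f_{b,b} v - f_{a,a} v`, the squares give nothing, and the `e_{i,i+1}` remove it. -/
theorem IsWhittaker.evenElt_smul {v : M} (hv : IsWhittaker n v) :
    IsWhittaker n (incl n (evenElt n) • v) := by
  rw [QueerW.evenElt_smul]
  constructor
  · intro b a hab
    have h1 : eG b a • (∑ i : Fin n, ∑ j : Fin n, if j < i then ((alt i * alt j) • fG i i • fG j j • v : M) else 0) =
        (∑ i : Fin n, ∑ j : Fin n, if j < i then ((alt i * alt j) • fG i i • fG j j • v : M) else 0) + v := by
      simp only [Finset.smul_sum, smul_ite, smul_zero, smul_comm (eG b a) (_ : ℂ),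
        eG_smul_fG_fG hv hab, smul_add, smul_smul (alt _ * alt _)]
      -- Since `a` and `b` are adjacent, `j < i` leaves only the correction at `(i, j) = (b, a)`,
      -- whose coefficient `-1` is cancelled by `alt b * alt a = -1`.
      have : ∀ i j : Fin n, (if j < i then (alt i * alt j) • fG i i • fG j j • v +
          (alt i * alt j * (((if i = a then 1 else 0) - (if i = b then 1 else 0)) *
          ((if j = a then 1 else 0) + (if j = b then 1 else 0)) : ℂ)) • v else 0) =
          (if j < i then (alt i * alt j) • fG i i • fG j j • v else 0) +
          if i = b then (if j = a then v else 0) else 0 := by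
        intro i j
        by_cases hji : j < i
        · rw [if_pos hji, if_pos hji]
          congr 1
          by_cases h : i = a
          · subst h
            have : j ≠ b := by rintro rfl; rw [Fin.lt_def] at hji; omega
            have hne : i ≠ b := by rintro rfl; omega
            simp [this, hne, hji.ne]
          · by_cases h' : i = b
            · subst h'
              by_cases h'' : j = a
              · subst h''
                simp [h, hji.ne, alt_succ hab, alt_mul_self]
              · simp [h, h'', hji.ne]
            · simp [h, h']
        · rw [if_neg hji, if_neg hji, zero_add]
          by_cases h' : i = b
          · subst h'
            have : j ≠ a := by rintro rfl; rw [Fin.lt_def] at hji; omega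
            simp [this]
          · simp [h']
      simp only [this, Finset.sum_add_distrib]
      simp
    have h2 : eG b a • (∑ i : Fin n, eG i i • eG i i • v) = (∑ i : Fin n, eG i i • eG i i • v) +
        (((2 : ℂ) • eG a a • v + v) + (v - (2 : ℂ) • eG b b • v)) := by
      simp [Finset.smul_sum, eG_smul_eG_eG hv hab, Finset.sum_add_distrib]
    have h3 : eG b a • (∑ i : Fin n, ∑ j : Fin n, if (j : ℕ) = i + 1 then eG i j • v else 0) =
        (∑ i : Fin n, ∑ j : Fin n, if (j : ℕ) = i + 1 then eG i j • v else 0) +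
        (eG b b • v - eG a a • v) := by
      rw [← sum_succ_eq hab (eG b b • v - eG a a • v)]
      simp only [Finset.smul_sum, ← Finset.sum_add_distrib]
      refine Finset.sum_congr rfl fun i _ => Finset.sum_congr rfl fun j _ => ?_
      by_cases h : (j : ℕ) = i + 1
      · simp only [if_pos h, eG_smul_eG_succ hv hab i j h]
      · simp [h]
    rw [smul_sub, smul_sub, smul_comm (eG b a), h1, h2, h3]
    generalize (∑ i : Fin n, ∑ j : Fin n,
      if j < i then ((alt i * alt j) • fG i i • fG j j • v : M) else 0) = S
    generalize (∑ i : Fin n, ∑ j : Fin n, if (j : ℕ) = i + 1 then eG i j • v else 0) = R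
    generalize (∑ i : Fin n, eG i i • eG i i • v) = Q
    generalize eG a a • v = u
    generalize eG b b • v = w
    module
  · intro b a hab
    have h1 : fG b a • (∑ i : Fin n, ∑ j : Fin n, if j < i then ((alt i * alt j) • fG i i • fG j j • v : M) else 0) =
        fG b b • v - fG a a • v := by
      -- Opposite signs at `a` and `b` turn the symmetric coefficient of the odd action into a
      -- difference, so the sums over `j < i` telescope.
      have hsgn : ∀ i, alt i * ((if i = a then 1 else 0) + (if i = b then 1 else 0)) =
          alt a * ((if i = a then 1 else 0) - (if i = b then 1 else 0)) := by
        intro i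
        have hne : a ≠ b := by rintro rfl; omega
        by_cases h : i = a
        · subst h; simp [hne]
        · by_cases h' : i = b
          · subst h'; simp [h, alt_succ hab]
          · simp [h, h']
      have hterm : ∀ i j : Fin n, fG b a • (alt i * alt j) • fG i i • fG j j • v =
          alt a • (((if i = a then 1 else 0) - (if i = b then 1 else 0) : ℂ) • alt j • fG j j • v -
            ((if j = a then 1 else 0) - (if j = b then 1 else 0) : ℂ) • alt i • fG i i • v) := by
        intro i j
        rw [smul_comm (fG b a) (_ : ℂ), fG_smul_fG_fG hv hab, smul_sub, smul_sub, smul_smul,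
          smul_smul, smul_smul, smul_smul, smul_smul, smul_smul]
        congr 2
        · linear_combination alt j * hsgn i
        · linear_combination alt i * hsgn j
      -- No index lies strictly between `a` and `b`, so the two thresholds differ at a single index.
      have hcount : ∀ j : Fin n, (if j < a then (1 : ℂ) else 0) - (if j < b then 1 else 0) =
          - if j = a then 1 else 0 := by
        intro j
        simp only [Fin.lt_def, Fin.ext_iff]
        split_ifs <;> first | omega | simp
      have hcount' : ∀ i : Fin n, (if a < i then (1 : ℂ) else 0) - (if b < i then 1 else 0) =
          if i = b then 1 else 0 := by
        intro j
        simp only [Fin.lt_def, Fin.ext_iff]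
        split_ifs <;> first | omega | simp
      have hfst : (∑ i, ∑ j, if j < i then
          (((if i = a then 1 else 0) - (if i = b then 1 else 0) : ℂ) • alt j • fG j j • v) else 0) =
          - alt a • fG a a • v := by
        rw [Finset.sum_comm]
        have : ∀ j : Fin n, (∑ i, if j < i then
            (((if i = a then 1 else 0) - (if i = b then 1 else 0) : ℂ) • alt j • fG j j • v)
            else 0) = (- if j = a then 1 else 0 : ℂ) • alt j • fG j j • v := by
          intro j
          rw [← hcount j, ← Finset.sum_filter, ← Finset.sum_smul, Finset.sum_filter]
          congr 1
          simp [← Finset.sum_filter, Finset.sum_sub_distrib]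
        simp [this]
      have hsnd : (∑ i, ∑ j, if j < i then
          (((if j = a then 1 else 0) - (if j = b then 1 else 0) : ℂ) • alt i • fG i i • v) else 0) =
          alt b • fG b b • v := by
        have : ∀ i : Fin n, (∑ j, if j < i then
            (((if j = a then 1 else 0) - (if j = b then 1 else 0) : ℂ) • alt i • fG i i • v)
            else 0) = (if i = b then 1 else 0 : ℂ) • alt i • fG i i • v := by
          intro j
          rw [← hcount' j, ← Finset.sum_filter, ← Finset.sum_smul, Finset.sum_filter]
          congr 1
          simp [← Finset.sum_filter, Finset.sum_sub_distrib]
        simp [this]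
      have hsplit : fG b a • (∑ i : Fin n, ∑ j : Fin n, if j < i then
          ((alt i * alt j) • fG i i • fG j j • v : M) else 0) =
          alt a • (- alt a • fG a a • v - alt b • fG b b • v) := by
        rw [← hfst, ← hsnd]
        simp only [Finset.smul_sum, ← Finset.sum_sub_distrib]
        refine Finset.sum_congr rfl fun i _ => Finset.sum_congr rfl fun j _ => ?_
        by_cases h : j < i
        · simp only [if_pos h, hterm i j]
        · simp [h]
      rw [hsplit, alt_succ hab, smul_sub, smul_smul, smul_smul, mul_neg, alt_mul_self]
      generalize fG a a • v = u
      generalize fG b b • v = w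
      module
    have h2 : fG b a • (∑ i : Fin n, eG i i • eG i i • v) = 0 := by
      simp [Finset.smul_sum, fG_smul_eG_eG hv hab]
    have h3 : fG b a • (∑ i : Fin n, ∑ j : Fin n, if (j : ℕ) = i + 1 then eG i j • v else 0) =
        fG b b • v - fG a a • v := by
      rw [← sum_succ_eq hab (fG b b • v - fG a a • v)]
      simp only [Finset.smul_sum]
      refine Finset.sum_congr rfl fun i _ => Finset.sum_congr rfl fun j _ => ?_
      by_cases h : (j : ℕ) = i + 1
      · simp only [if_pos h, fG_smul_eG_succ hv hab i j h]
      · simp [h]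
    rw [smul_sub, smul_sub, smul_comm (fG b a), h1, h2, h3]
    simp

theorem oddElt_mem_W : oddElt n ∈ W n := mem_W_of_isWhittaker isWhittaker_mk_one.oddElt_smul

theorem evenElt_mem_W : evenElt n ∈ W n := mem_W_of_isWhittaker isWhittaker_mk_one.evenElt_smul

/-! ### The action on modules over the Cartan subalgebra -/

/-- The odd generator `ξᵢ = f_{i,i}` of `U(h)`. -/
def xiElt (i : Fin n) : Env (hAlg n) := Env.ι (hAlg n) ⟨fMat i i, fMat_mem_queer rfl⟩

theorem eDiag_eq (i : Fin n) : eDiag i = ⟨eMat i i, eMat_mem_queer rfl⟩ := by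
  apply Subtype.ext
  ext (a | a) (c | c) <;>
  simp [eDiag, eMat, Matrix.diagonal_apply, Matrix.single_apply, pos, ite_and, eq_comm] <;>
  grind

theorem xiElt_anticomm (i j : Fin n) :
    xiElt i * xiElt j + xiElt j * xiElt i = if i = j then (2 : ℂ) • xElt i else 0 := by
  have hm : ∀ i : Fin n, fMat i i ∈ (hAlg n).carrier := fun i => fMat_mem_queer rfl
  have h := Env.bracket (hAlg n) 1 1 ⟨_, hm i⟩ ⟨_, hm j⟩ (fMat_mem_part i i) (fMat_mem_part j j)
  have h2 : (⟨fMat i i * fMat j j - sgn (1 * 1) • (fMat j j * fMat i i),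
      (hAlg n).bracket_mem 1 1 _ _ (hm i) (fMat_mem_part i i) (hm j)
        (fMat_mem_part j j)⟩ : (hAlg n).carrier) = if i = j then (2 : ℂ) • eDiag i else 0 := by
    apply Subtype.ext
    simp only [fMat_mul_fMat, sgn, eDiag_eq]
    split_ifs with h1 h2 h2
    · subst h1; simp [ZMod.val_one, two_smul]
    · exact absurd h1.symm h2
    · exact absurd h2.symm h1
    · simp
  rw [h2, apply_ite (Env.ι _), map_smul, map_zero] at h
  simp only [sgn, mul_one, ZMod.val_one, pow_one, neg_smul, one_smul, sub_neg_eq_add] at h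
  exact h

theorem harishChandra_eB (i j : Fin n) (h : i ≤ j) :
    harishChandra n (eB i j h) = if i = j then xElt i else 0 := by
  rw [eB, harishChandra_ι]
  split_ifs with hij
  · subst hij
    rw [xElt, eDiag_eq]
    refine congrArg (Env.ι (hAlg n)) (Subtype.ext ?_)
    ext (a | a) (c | c) <;> simp [diagPart_apply, eMat, pos, Matrix.single_apply] <;> grind
  · refine (congrArg (Env.ι (hAlg n)) (Subtype.ext ?_)).trans (map_zero _)
    ext (a | a) (c | c) <;> simp [diagPart_apply, eMat, pos, Matrix.single_apply] <;> grind

theorem harishChandra_fB (i : Fin n) : harishChandra n (fB i) = xiElt i := by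
  rw [fB, harishChandra_ι]
  refine congrArg (Env.ι (hAlg n)) (Subtype.ext ?_)
  ext (a | a) (c | c) <;> simp [diagPart_apply, fMat, pos, Matrix.single_apply] <;> grind

theorem harishChandra_oddElt : harishChandra n (oddElt n) = ∑ i, alt i • xiElt i := by
  simp [oddElt, map_sum, harishChandra_fB]

/-- The `e_{i,i+1}`, indispensable for membership in `W`, lie in `n⁺` and disappear here. -/
theorem harishChandra_evenElt : harishChandra n (evenElt n) =
    (∑ i, ∑ j, if j < i then (alt i * alt j) • (xiElt i * xiElt j) else 0)
    - (1 / 2 : ℂ) • (∑ i, xElt i * xElt i) := by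
  have h : ∀ i j : Fin n, (if (j : ℕ) = i + 1 then (if i = j then xElt i else 0) else 0) = 0 := by
    intro i j
    by_cases hij : i = j
    · subst hij; simp
    · simp [hij]
  simp only [evenElt, map_sub, map_sum, map_smul, map_mul, apply_dite (harishChandra n),
    apply_ite (harishChandra n), harishChandra_fB, map_zero, harishChandra_eB,
    if_true, dite_eq_ite, h, Finset.sum_const_zero, sub_zero]

/-- A subspace stable under the `xᵢ` and the `ξᵢ` is a `U(h)`-submodule. -/
theorem stable_of_generators {V : Type*} [AddCommGroup V] [Module ℂ V]
    (ρ : Env (hAlg n) →ₐ[ℂ] Module.End ℂ V) (N : Submodule ℂ V)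
    (hx : ∀ i, ∀ v ∈ N, ρ (xElt i) v ∈ N) (hξ : ∀ i, ∀ v ∈ N, ρ (xiElt i) v ∈ N)
    (u : Env (hAlg n)) (v : V) (hv : v ∈ N) : ρ u v ∈ N := by
  let K : Subalgebra ℂ (Env (hAlg n)) :=
    { carrier := {u | ∀ v ∈ N, ρ u v ∈ N}
      mul_mem' := fun ha hb v hv => by
        rw [map_mul]
        exact ha _ (hb v hv)
      add_mem' := fun ha hb v hv => by
        rw [map_add]
        exact N.add_mem (ha v hv) (hb v hv)
      algebraMap_mem' := fun r v hv => by
        rw [AlgHom.commutes]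
        exact N.smul_mem r hv }
  have hK : K = ⊤ := by
    refine Env.induction K fun x => ?_
    have hle := queer_induction (S := fun i j : Fin n => i = j) (hS := fun _ _ _ => Eq.trans)
      (((Subalgebra.toSubmodule K).comap (Env.ι (hAlg n))).map (hAlg n).carrier.subtype)
      (by
        rintro i _ rfl
        refine ⟨eDiag i, hx i, ?_⟩
        rw [eDiag_eq]
        rfl)
      (by
        rintro i _ rfl
        exact ⟨_, hξ i, rfl⟩)
    obtain ⟨y, hy, hyx⟩ := hle x.2
    obtain rfl : y = x := Subtype.ext hyx
    exact hy
  have : u ∈ K := hK ▸ Algebra.mem_top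
  exact this v hv

/-- In a Clifford algebra, commutation with `∑_{j < i} ηᵢ ηⱼ` acts on the span of the generators
as `2 signOp`. -/
theorem commutator_eq_signOp {A : Type*} [Ring A] [Algebra ℂ A] (s : Fin n → ℂ) (η : Fin n → A)
    (hη : ∀ i j, η i * η j + η j * η i = if i = j then algebraMap ℂ A (2 * s i) else 0)
    (c : Fin n → ℂ) :
    (∑ i, ∑ j, if j < i then η i * η j else 0) * (∑ k, c k • η k) -
      (∑ k, c k • η k) * (∑ i, ∑ j, if j < i then η i * η j else 0) =
    (2 : ℂ) • ∑ i, signOp s c i • η i := by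
  have hk : ∀ i, η i * (∑ k, c k • η k) + (∑ k, c k • η k) * η i =
      algebraMap ℂ A (2 * s i * c i) := by
    intro i
    simp only [Finset.mul_sum, Finset.sum_mul, ← Finset.sum_add_distrib, mul_smul_comm,
      smul_mul_assoc, ← smul_add, hη]
    simp [Algebra.smul_def, mul_comm]
  set C := ∑ k, c k • η k with hC
  have hij : ∀ i j, η i * η j * C - C * (η i * η j) =
      (2 * (s j * c j)) • η i - (2 * (s i * c i)) • η j := by
    intro i j
    have h1 := hk i
    have h2 := hk j
    -- Super-Leibniz rule: the commutator with a product of two odd elements is expressed by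
    -- anticommutators, which are scalars by `hk`.
    have : η i * η j * C - C * (η i * η j) =
        η i * (η j * C + C * η j) - (η i * C + C * η i) * η j := by noncomm_ring
    rw [this, h1, h2, ← Algebra.commutes, ← Algebra.smul_def, ← Algebra.smul_def, mul_assoc,
      mul_assoc]
  have hsum : (∑ i, ∑ j, if j < i then η i * η j else 0) * C -
      C * (∑ i, ∑ j, if j < i then η i * η j else 0) =
      (∑ i, ∑ j, if j < i then (2 * (s j * c j)) • η i else 0) -
      (∑ i, ∑ j, if j < i then (2 * (s i * c i)) • η j else 0) := by
    simp only [Finset.mul_sum, Finset.sum_mul, ← Finset.sum_sub_distrib]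
    refine Finset.sum_congr rfl fun i _ => Finset.sum_congr rfl fun j _ => ?_
    split_ifs
    · exact hij i j
    · simp
  rw [hsum, Finset.sum_comm (f := fun i j => if j < i then (2 * (s i * c i)) • η j else 0),
    Finset.smul_sum, ← Finset.sum_sub_distrib]
  refine Finset.sum_congr rfl fun i _ => ?_
  rw [signOp_apply, smul_smul, Finset.mul_sum, Finset.sum_smul, ← Finset.sum_sub_distrib]
  refine Finset.sum_congr rfl fun j _ => ?_
  split_ifs <;> module

end QueerW

end

/-! ### Simplicity over `W`. -/

theorem mainTheorem3 (n : ℕ) (s : Fin n → ℂ) (hs : QueerW.Typical s)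
    {V : Type*} [AddCommGroup V] [Module ℂ V] (𝒱 : ZMod 2 → Submodule ℂ V)
    (ρ : QueerW.Env (QueerW.hAlg n) →ₐ[ℂ] Module.End ℂ V) (hV : QueerW.IsVs s 𝒱 ρ) :
    QueerW.IsSimpleSupermodule (QueerW.W.part n) 𝒱 (QueerW.resW ρ) := by
  open QueerW in
  refine ⟨hV.simple.internal, fun p q a ha v hv => ?_, hV.simple.nontrivial, fun N hN hstab => ?_⟩
  · exact hV.simple.graded p q _ (harishChandra_mem_part ha) v hv
  refine hV.simple.simple N hN ?_
  -- The rescaling by signs keeps the Clifford relations, because `alt i * alt i = 1`, and turns the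
  -- odd element into the vector of ones.
  let η : Fin n → Module.End ℂ V := fun i => alt i • ρ (xiElt i)
  have hη : ∀ i j, η i * η j + η j * η i =
      if i = j then algebraMap ℂ (Module.End ℂ V) (2 * s i) else 0 := by
    intro i j
    have h := congrArg ρ (xiElt_anticomm i j)
    rw [map_add, map_mul, map_mul, apply_ite ρ, map_smul, hV.weight, map_zero] at h
    simp only [η, smul_mul_smul_comm, mul_comm (alt j), ← smul_add, h]
    split_ifs with hij
    · subst hij
      rw [alt_mul_self, one_smul, Algebra.smul_def, ← map_mul]
    · simp
  have hodd : ∀ v ∈ N, (∑ i, (1 : ℂ) • η i) v ∈ N := by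
    intro v hv
    have h := hstab ⟨oddElt n, oddElt_mem_W⟩ v hv
    change ρ (harishChandra n (oddElt n)) v ∈ N at h
    rw [harishChandra_oddElt, map_sum] at h
    simpa only [map_smul, one_smul, η] using h
  have heven : ∀ v ∈ N, (∑ i, ∑ j, if j < i then η i * η j else 0) v ∈ N := by
    intro v hv
    have h := hstab ⟨evenElt n, evenElt_mem_W⟩ v hv
    change ρ (harishChandra n (evenElt n)) v ∈ N at h
    have h2 : ρ (harishChandra n (evenElt n)) =
        (∑ i, ∑ j, if j < i then η i * η j else 0) -
          algebraMap ℂ _ ((1 / 2) * ∑ i, s i * s i) := by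
      simp only [harishChandra_evenElt, map_sub, map_sum, map_smul, map_mul, apply_ite ρ, map_zero,
        hV.weight, η, smul_mul_smul_comm]
      simp only [Algebra.smul_def, map_mul]
    rw [h2, LinearMap.sub_apply] at h
    -- The squares `x_i²` act by scalars, so adding that multiple of `v` back leaves `q` alone.
    have h3 := N.add_mem h (N.smul_mem ((1 / 2) * ∑ i, s i * s i) hv)
    rwa [Module.algebraMap_end_apply, sub_add_cancel] at h3
  let L : Submodule ℂ (Fin n → ℂ) :=
    { carrier := {c | ∀ v ∈ N, (∑ i, c i • η i) v ∈ N}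
      add_mem' := fun ha hb v hv => by
        simp only [Pi.add_apply, add_smul, Finset.sum_add_distrib]
        exact N.add_mem (ha v hv) (hb v hv)
      zero_mem' := fun v _ => by simp
      smul_mem' := fun r c hc v hv => by
        simp only [Pi.smul_apply, smul_assoc, ← Finset.smul_sum]
        exact N.smul_mem r (hc v hv) }
  have hL : L = ⊤ := by
    refine eq_top_of_signOp_invariant s hs L hodd fun c hc v hv => ?_
    -- A commutator of two operators preserving `N` preserves `N`.
    have h := N.sub_mem (heven _ (hc v hv)) (hc _ (heven v hv))
    rw [← Module.End.mul_apply, ← Module.End.mul_apply, ← LinearMap.sub_apply,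
      commutator_eq_signOp s η hη c, LinearMap.smul_apply] at h
    exact (N.smul_mem_iff two_ne_zero).mp h
  refine fun u v hv => stable_of_generators ρ N (fun i v hv => ?_) (fun i v hv => ?_) u v hv
  · rw [hV.weight]
    exact N.smul_mem _ hv
  · have hc : Pi.single i (alt i) ∈ L := hL ▸ Submodule.mem_top
    have h := hc v hv
    rw [Finset.sum_eq_single i (fun j _ hj => by simp [hj]) (by simp), Pi.single_eq_same,
      smul_smul, alt_mul_self, one_smul] at h
    exact h
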